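/- Let $w>0$. A random variable $X$ has $\kappa$-$\mu$ shadowed (power) distribution with parameters $(\mu,\kappa,m)$, $\mu,\kappa,m>0$, and mean power $w$ if it has density on $(0,\infty)$ $$f_X(x)=\frac{\theta_1^{m-\mu}x^{\mu-1}}{\theta_2^{m}\,\Gamma(\mu)}\,e^{-x/\theta_1}\,{}_1F_1\!\Big(m;\mu;\frac{(\theta_2-\theta_1)x}{\theta_1\theta_2}\Big),\qquad \theta_1=\frac{w}{\mu(1+\kappa)},\quad \theta_2=\frac{(\mu\kappa+m)\,w}{\mu(1+\kappa)m}.$$ Lauricella's function of the fourth kind $F_D^{(N)}(a,b_1,\dots,b_N;c;z_1,\dots,z_N)$ is $$\sum_{k_1,\dots,k_N\ge 0}\frac{(a)_{k_1+\cdots+k_N}(b_1)_{k_1}\cdots(b_N)_{k_N}}{(c)_{k_1+\cdots+k_N}}\,\frac{z_1^{k_1}}{k_1!}\cdots\frac{z_N^{k_N}}{k_N!}\qquad(|z_i|<1\text{ for all }i),$$ continued analytically (principal branch) to $(\mathbb C\setminus[1,\infty))^N$. **Theorem.** Let $L\ge 1$. Let the desired fading power $g_d$ be $\kappa$-$\mu$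 shadowed with parameters $(\mu,\kappa,m)$, and let the fading powers $g_1,\dots,g_L$ of the $L$ interferers be $\kappa$-$\mu$ shadowed with (possibly different) parameters $(\mu_l,\kappa_l,m_l)$, all of unit mean power, where $\mu>\tfrac12$ and $\kappa,m,\mu_l,\kappa_l,m_l>0$. Let $g_1,\dots,g_L$ be independent, with $(g_1,\dots,g_L)$ independent of $g_d$, and put $g_I=\sum_{l=1}^L g_l$. For noise variance $\sigma^2$ the error vector magnitude is $\mathrm{EVM}=\mathbb E\big[\sqrt{(g_I+\sigma^2)/g_d}\,\big]$. In the interference-limited case $\sigma^2=0$ this expectation is finite and, with $$\theta_1=\frac1{\mu(1+\kappa)},\quad \theta_2=\frac{\mu\kappa+m}{\mu(1+\kappa)m},\quad \theta_{1l}=\frac1{\mu_l(1+\kappa_l)},\quad \theta_{2l}=\frac{\mu_l\kappa_l+m_l}{\mu_l(1+\kappa_l)m_l},$$ $$\begin{aligned}\mathrm{EVM}={}&\Big(\prod_{l=1}^L\theta_{1l}^{m_l-\mu_l}\theta_{2l}^{-m_l}\Big)\,\theta_1^{m-\mu}\,\theta_2^{-m}\,\theta_1^{\mu-\frac12}\;{}_2F_1\!\Big(\mu-\tfrac12,m;\mu;\frac{\mu\kappa}{m+\mu\kappa}\Big)\,\theta_{11}^{\sum_l\mu_l+\frac12}\,\frac{\Gamma(\mu-\frac12)\,\Gamma(\sum_l\mu_l+\frac12)}{\Gamma(\mu)\,\Gamma(\sum_l\mu_l)}\\&\times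 F_D^{(2L-1)}\Big(\sum_{l}\mu_l+\tfrac12,\ \mu_2-m_2,\dots,\mu_L-m_L,\ m_1,\dots,m_L;\ \sum_l\mu_l;\ 1-\tfrac{\theta_{11}}{\theta_{12}},\dots,1-\tfrac{\theta_{11}}{\theta_{1L}},\ 1-\tfrac{\theta_{11}}{\theta_{21}},\dots,1-\tfrac{\theta_{11}}{\theta_{2L}}\Big).\end{aligned}$$ Here the principal branch of this $F_D^{(2L-1)}$ exists (and is unique), and its argument point lies in $(\mathbb C\setminus[1,\infty))^{2L-1}$. -/

import Mathlib

open MeasureTheory ProbabilityTheory Set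

noncomputable section

/-- Kummer's confluent hypergeometric function `₁F₁(a; b; z) = ∑ (a)ₙ / (b)ₙ · zⁿ / n!`. -/
def kummerHypergeometric (a b z : ℝ) : ℝ :=
  ∑' n : ℕ, (ascPochhammer ℝ n).eval a / ((ascPochhammer ℝ n).eval b * (n.factorial : ℝ)) * z ^ n

/-- Density of the κ-μ shadowed fading power with parameters `(μ, κ, m)` and mean power `w`. -/
def kappaMuShadowedPDF (μ κ m w x : ℝ) : ℝ :=
  let θ₁ : ℝ := w / (μ * (1 + κ))
  let θ₂ : ℝ := (μ * κ + m) * w / (μ * (1 + κ) * m)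
  if 0 < x then
    θ₁ ^ (m - μ) * x ^ (μ - 1) / (θ₂ ^ m * Real.Gamma μ) * Real.exp (-x / θ₁)
      * kummerHypergeometric m μ ((θ₂ - θ₁) * x / (θ₁ * θ₂))
  else 0

/-- The law on `ℝ` of the κ-μ shadowed fading power with parameters `(μ, κ, m)`, mean power `w`. -/
def kappaMuShadowed (μ κ m w : ℝ) : Measure ℝ :=
  volume.withDensity fun x => ENNReal.ofReal (kappaMuShadowedPDF μ κ m w x)

/-- The error vector magnitude `E[√((g_I + σ²) / g_d)]`, where `gd` is the desired fading power,
`gI` the total interfering fading power, and `σ2` the noise variance (unit symbol energy). -/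
def evm {Ω : Type*} [MeasurableSpace Ω] (P : Measure Ω) (σ2 : ℝ) (gd gI : Ω → ℝ) : ℝ :=
  ∫ ω, √((gI ω + σ2) / gd ω) ∂P

/-- The general term of Lauricella's fourth series
`F_D(a, b; c; z) = ∑_k (a)_{|k|} ∏ (b_i)_{k_i} / (c)_{|k|} · ∏ z_i ^ {k_i} / k_i!`. -/
def lauricellaFDTerm {ι : Type*} [Fintype ι] (a : ℂ) (b : ι → ℂ) (c : ℂ) (z : ι → ℂ)
    (k : ι → ℕ) : ℂ :=
  (ascPochhammer ℂ (∑ i, k i)).eval a / (ascPochhammer ℂ (∑ i, k i)).eval c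
    * ∏ i, ((ascPochhammer ℂ (k i)).eval (b i) / ((k i).factorial : ℂ) * z i ^ k i)

/-- The domain of the principal branch of `F_D`: no coordinate lies on the cut `[1, ∞)`. -/
def lauricellaFDDomain (ι : Type*) : Set (ι → ℂ) :=
  {z | ∀ i, 1 - z i ∈ Complex.slitPlane}

/-- `F` is the principal branch of `F_D(a, b; c; ·)`: the sum of Lauricella's series on the unit
polydisc, continued analytically to `(ℂ ∖ [1, ∞))^ι`. -/
structure IsLauricellaFD {ι : Type*} [Fintype ι] (a : ℂ) (b : ι → ℂ) (c : ℂ)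
    (F : (ι → ℂ) → ℂ) : Prop where
  analytic : AnalyticOnNhd ℂ F (lauricellaFDDomain ι)
  hasSum : ∀ z : ι → ℂ, (∀ i, ‖z i‖ < 1) → HasSum (lauricellaFDTerm a b c z) (F z)

/-- The analytic continuation is unique. -/
theorem IsLauricellaFD.eqOn {ι : Type*} [Fintype ι] {a : ℂ} {b : ι → ℂ} {c : ℂ}
    {F G : (ι → ℂ) → ℂ} (hF : IsLauricellaFD a b c F) (hG : IsLauricellaFD a b c G) :
    EqOn F G (lauricellaFDDomain ι) := by
  have h0 : (0 : ι → ℂ) ∈ lauricellaFDDomain ι := by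
    intro i; simp
  have hstar : StarConvex ℝ (0 : ι → ℂ) (lauricellaFDDomain ι) := by
    intro z hz s t hs ht hst i
    have h := Complex.starConvex_one_slitPlane (hz i) hs ht hst
    have e : s • (1 : ℂ) + t • (1 - z i) = 1 - (s • (0 : ι → ℂ) + t • z) i := by
      have hc : (s : ℂ) + t = 1 := by exact_mod_cast hst
      simp only [Complex.real_smul, Pi.add_apply, Pi.smul_apply, Pi.zero_apply]
      linear_combination hc
    rwa [e] at h
  have hconn : IsPreconnected (lauricellaFDDomain ι) :=
    (hstar.isPathConnected h0).isConnected.isPreconnected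
  refine hF.analytic.eqOn_of_preconnected_of_eventuallyEq hG.analytic hconn h0 ?_
  filter_upwards [Metric.ball_mem_nhds (0 : ι → ℂ) one_pos] with z hz
  have hz' : ∀ i, ‖z i‖ < 1 := fun i =>
    (norm_le_pi_norm z i).trans_lt (by simpa using hz)
  exact (hF.hasSum z hz').unique (hG.hasSum z hz')

open Classical in
/-- Lauricella's function of the fourth kind `F_D(a, b; c; z)` (principal branch; the number of
variables is the cardinality of `ι`). -/
def lauricellaFD {ι : Type*} [Fintype ι] (a : ℂ) (b : ι → ℂ) (c : ℂ) : (ι → ℂ) → ℂ :=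
  if h : ∃ F, IsLauricellaFD a b c F then h.choose else 0

end

/-!
Write `S = ∑ μₗ` and let `X = ∑ gₗ` be the total interference. Since `X` and `g_d` are independent,
the expectation of `√(X / g_d)` is `E[√X] · E[g_d ^ (-1/2)]`.

Integrating the series of `₁F₁` term by term gives all tilted fractional moments of a
κ-μ shadowed variable (`lintegral_rpow_mul_exp_kappaMuShadowed`). The moment of order `-1/2` is a
value of `₂F₁`, and the moment of order `0` is the Laplace transform
`θ₁^(m-μ) θ₂^(-m) (s + 1/θ₁)^(m-μ) (s + 1/θ₂)^(-m)`. Hence the Laplace transform of `X` is a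
constant times a product of powers of linear forms in `s` whose exponents add up to `-S`.

The half moment of `X` is recovered from `√x = Γ(1/2)⁻¹ ∫₀^∞ s^(-1/2) x e^(-s x) ds`
(`lintegral_sqrt_eq_lintegral_deriv_mgf`). The substitution `s = Λ (1 - t) / t` with `Λ = 1/θ₁₁`
turns the linear forms `s + l` into `(Λ / t) (1 - t (1 - l / Λ))`, so that an integral over `(0, 1)`
appears whose integrand is `t^(S-1/2) (1-t)^(-1/2)` times
`(S + t d/dt) ∏ᵢ (1 - t zᵢ)^(-bᵢ)` (`lintegral_sqrt_of_mgf_eq_prod`).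

This is exactly an integral representation of the principal branch of `F_D(S + 1/2, b; S; z)`. The
usual Euler integral is not available, because `a = S + 1/2` exceeds `c = S`; but it is available
for `c + 1` in place of `c`, and the operator `(c + ∑ zᵢ ∂ᵢ) / c` lowers that parameter
(`lauricellaEuler`). On the polydisc the integrand is expanded in binomial series
(`hasSum_lauricellaEuler`). Off the cuts the integral is analytic in all variables jointly, because
it is a continuous linear functional of a product of one-variable analytic functions with values in
the Banach algebra `C([0, 1], ℂ)` (`analyticOnNhd_lauricellaEuler`). So the point at which `F_D` is
evaluated needs no restriction to the polydisc.
-/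

open MeasureTheory ProbabilityTheory Set

noncomputable section

/-! ### Kummer, Gauss and binomial series -/

lemma Real.Gamma_add_natCast {x : ℝ} (hx : 0 < x) (n : ℕ) :
    Real.Gamma (x + n) = Real.Gamma x * (ascPochhammer ℝ n).eval x := by
  induction n with
  | zero => simp
  | succ n ih =>
    have h : x + n ≠ 0 := by positivity
    rw [Nat.cast_succ, ← add_assoc, Real.Gamma_add_one h, ih, ascPochhammer_succ_eval]
    ring

lemma summable_kummerHypergeometric (a : ℝ) {b : ℝ} (hb : 0 < b) (z : ℝ) :
    Summable fun n : ℕ ↦ (ascPochhammer ℝ n).eval a /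
      ((ascPochhammer ℝ n).eval b * (n.factorial : ℝ)) * z ^ n := by
  have hlim : Filter.Tendsto (fun n : ℕ ↦ ((a + n) / (b + n)) * (z / ((n : ℝ) + 1)))
      Filter.atTop (nhds (1 * 0)) := by
    refine Filter.Tendsto.mul ?_ ?_
    · simpa using tendsto_add_mul_div_add_mul_atTop_nhds a b (1 : ℝ) one_ne_zero
    · exact tendsto_const_nhds.div_atTop
        (Filter.tendsto_atTop_add_const_right _ _ tendsto_natCast_atTop_atTop)
  rw [mul_zero] at hlim
  have hev := hlim.norm.eventually (gt_mem_nhds (show ‖(0 : ℝ)‖ < 1 / 2 by norm_num))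
  refine summable_of_ratio_norm_eventually_le (r := 1 / 2) (by norm_num) ?_
  filter_upwards [hev] with n hn
  have h1 := (ascPochhammer_pos n _ hb).ne'
  have h2 : b + n ≠ 0 := by positivity
  have h3 : (n : ℝ) + 1 ≠ 0 := by positivity
  have h4 : (n.factorial : ℝ) ≠ 0 := by positivity
  have : (ascPochhammer ℝ (n + 1)).eval a /
      ((ascPochhammer ℝ (n + 1)).eval b * ((n + 1).factorial : ℝ)) * z ^ (n + 1)
      = (((a + n) / (b + n)) * (z / ((n : ℝ) + 1))) * ((ascPochhammer ℝ n).eval a /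
      ((ascPochhammer ℝ n).eval b * (n.factorial : ℝ)) * z ^ n) := by
    rw [ascPochhammer_succ_eval, ascPochhammer_succ_eval, Nat.factorial_succ]
    push_cast
    field_simp
    ring
  rw [this, norm_mul]
  exact mul_le_mul_of_nonneg_right hn.le (norm_nonneg _)

lemma measurable_kummerHypergeometric (a : ℝ) {b : ℝ} (hb : 0 < b) :
    Measurable (kummerHypergeometric a b) := by
  have h := fun z ↦ (summable_kummerHypergeometric a hb z).hasSum.tendsto_sum_nat
  refine measurable_of_tendsto_metrizable (f := fun N z ↦ ∑ n ∈ Finset.range N,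
    (ascPochhammer ℝ n).eval a / ((ascPochhammer ℝ n).eval b * (n.factorial : ℝ)) * z ^ n)
    (fun N ↦ by fun_prop) ?_
  rw [tendsto_pi_nhds]
  exact h

/-- The Gauss series converges on `[0, 1)`. -/
lemma hasSum_ordinaryHypergeometric {a b c x : ℝ} (ha : 0 < a) (hb : 0 < b) (hc : 0 < c)
    (hx0 : 0 ≤ x) (hx1 : x < 1) :
    HasSum (fun n : ℕ ↦ ((n.factorial : ℝ)⁻¹ * (ascPochhammer ℝ n).eval a *
      (ascPochhammer ℝ n).eval b * ((ascPochhammer ℝ n).eval c)⁻¹) * x ^ n)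
      (ordinaryHypergeometric a b c x) := by
  have hr : (ordinaryHypergeometricSeries ℝ a b c).radius = 1 := by
    refine ordinaryHypergeometricSeries_radius_eq_one _ _ _ _ fun k ↦ ?_
    have : (0 : ℝ) ≤ k := k.cast_nonneg
    refine ⟨?_, ?_, ?_⟩ <;> intro h <;> linarith
  have hs := (ordinaryHypergeometricSeries ℝ a b c).summable (x := x) (by
    rw [hr]; simp [abs_of_nonneg hx0, hx1, ← ofReal_norm])
  rw [ordinaryHypergeometric_eq_tsum]
  rw [ordinaryHypergeometricSeries_apply_eq'] at hs
  simpa only [smul_eq_mul] using hs.hasSum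

/-- The binomial series `(1 - z)^{-b} = ∑ (b)ₙ zⁿ / n!`. -/
lemma Complex.hasSum_one_sub_cpow_neg (b : ℂ) {z : ℂ} (hz : ‖z‖ < 1) :
    HasSum (fun n : ℕ ↦ (ascPochhammer ℂ n).eval b / (n.factorial : ℂ) * z ^ n)
      ((1 - z) ^ (-b)) := by
  have h := (Complex.one_div_one_sub_cpow_hasFPowerSeriesOnBall_zero b).hasSum (y := z)
    (by simpa [← ofReal_norm] using hz)
  rw [zero_add, one_div, ← Complex.cpow_neg] at h
  convert! h using 2 with n
  have h4 : (n.factorial : ℂ) ≠ 0 := by exact_mod_cast n.factorial_ne_zero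
  have := Ring.factorial_nsmul_multichoose_eq_ascPochhammer b n
  rw [Ring.multichoose_eq, nsmul_eq_mul, Polynomial.ascPochhammer_smeval_eq_eval] at this
  simp [← this, h4]
  ring

lemma ascPochhammer_eval_ofReal (n : ℕ) (x : ℝ) :
    (ascPochhammer ℂ n).eval (x : ℂ) = ((ascPochhammer ℝ n).eval x : ℝ) := by
  rw [← ascPochhammer_map Complex.ofRealHom, Polynomial.eval_map]
  exact Polynomial.eval₂_at_apply Complex.ofRealHom x

lemma Real.hasSum_one_sub_rpow_neg (b : ℝ) {x : ℝ} (hx : |x| < 1) :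
    HasSum (fun n : ℕ ↦ (ascPochhammer ℝ n).eval b / (n.factorial : ℝ) * x ^ n)
      ((1 - x) ^ (-b)) := by
  have h := Complex.hasSum_one_sub_cpow_neg b (z := x) (by simpa using hx)
  have h1 : 0 ≤ 1 - x := by linarith [(abs_lt.mp hx).2]
  rw [← Complex.hasSum_ofReal]
  convert! h using 2 with n
  · rw [ascPochhammer_eval_ofReal]; push_cast; rfl
  · rw [Complex.ofReal_cpow h1]; push_cast; rfl

lemma ordinaryHypergeometric_nonneg {a b c x : ℝ} (ha : 0 < a) (hb : 0 < b) (hc : 0 < c)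
    (hx0 : 0 ≤ x) (hx1 : x < 1) : 0 ≤ ordinaryHypergeometric a b c x := by
  refine (hasSum_ordinaryHypergeometric ha hb hc hx0 hx1).nonneg fun n ↦ ?_
  have h1 := ascPochhammer_pos n _ ha
  have h2 := ascPochhammer_pos n _ hb
  have h3 := ascPochhammer_pos n _ hc
  positivity

/-- `₂F₁(c, b; c; x)` reduces to the binomial series. -/
lemma ordinaryHypergeometric_binomial {b c x : ℝ} (hb : 0 < b) (hc : 0 < c)
    (hx0 : 0 ≤ x) (hx1 : x < 1) : ordinaryHypergeometric c b c x = (1 - x) ^ (-b) := by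
  refine (hasSum_ordinaryHypergeometric hc hb hc hx0 hx1).unique ?_
  convert! Real.hasSum_one_sub_rpow_neg b (x := x) (by rwa [abs_of_nonneg hx0]) using 2 with n
  have := (ascPochhammer_pos n _ hc).ne'
  field_simp

lemma lintegral_rpow_mul_exp_neg_mul_Ioi {a r : ℝ} (ha : 0 < a) (hr : 0 < r) :
    ∫⁻ x in Ioi (0 : ℝ), ENNReal.ofReal (x ^ (a - 1) * Real.exp (-(r * x))) =
      ENNReal.ofReal (r ^ (-a) * Real.Gamma a) := by
  have hi : IntegrableOn (fun x : ℝ ↦ x ^ (a - 1) * Real.exp (-(r * x))) (Ioi 0) := by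
    have := integrableOn_rpow_mul_exp_neg_mul_rpow (p := 1) (s := a - 1) (b := r)
      (by linarith) one_pos hr
    simpa using this
  rw [← ofReal_integral_eq_lintegral_ofReal hi, Real.integral_rpow_mul_exp_neg_mul_Ioi ha hr,
    one_div, Real.inv_rpow hr.le, Real.rpow_neg hr.le]
  filter_upwards [ae_restrict_mem measurableSet_Ioi] with x hx
  have : 0 < x := hx
  positivity

/-- Laplace transform of `₁F₁`, obtained by integrating the series term by term. -/
lemma lintegral_kummerHypergeometric {a m b p y : ℝ} (ha : 0 < a) (hm : 0 < m) (hb : 0 < b)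
    (hy : 0 ≤ y) (hyp : y < p) :
    ∫⁻ x in Ioi (0 : ℝ), ENNReal.ofReal
        (x ^ (a - 1) * Real.exp (-(p * x)) * kummerHypergeometric m b (y * x)) =
      ENNReal.ofReal (p ^ (-a) * Real.Gamma a * ordinaryHypergeometric a m b (y / p)) := by
  have hp : 0 < p := hy.trans_lt hyp
  have hΓ := Real.Gamma_pos_of_pos ha
  set T : ℕ → ℝ := fun n ↦ (ascPochhammer ℝ n).eval m /
      ((ascPochhammer ℝ n).eval b * (n.factorial : ℝ)) * y ^ n with hT
  have hT0 : ∀ n, 0 ≤ T n := fun n ↦ by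
    have h1 := ascPochhammer_pos n _ hm
    have h2 := ascPochhammer_pos n _ hb
    simp only [hT]; positivity
  have hsplit : ∀ x ∈ Ioi (0 : ℝ), ENNReal.ofReal
        (x ^ (a - 1) * Real.exp (-(p * x)) * kummerHypergeometric m b (y * x)) =
      ∑' n : ℕ, ENNReal.ofReal (T n) *
        ENNReal.ofReal (x ^ (a + n - 1) * Real.exp (-(p * x))) := by
    intro x hx
    have hx : 0 < x := hx
    have h := (summable_kummerHypergeometric m hb (y * x)).hasSum.mul_left
      (x ^ (a - 1) * Real.exp (-(p * x)))
    have e : ∀ n : ℕ, x ^ (a - 1) * Real.exp (-(p * x)) * ((ascPochhammer ℝ n).eval m /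
      ((ascPochhammer ℝ n).eval b * (n.factorial : ℝ)) * (y * x) ^ n) =
        T n * (x ^ (a + n - 1) * Real.exp (-(p * x))) := by
      intro n
      rw [show a + n - 1 = (a - 1) + n by ring, Real.rpow_add_natCast hx.ne', mul_pow]
      simp only [hT]; ring
    simp only [e] at h
    rw [kummerHypergeometric, ← h.tsum_eq, ENNReal.ofReal_tsum_of_nonneg _ h.summable]
    · exact tsum_congr fun n ↦ ENNReal.ofReal_mul (hT0 n)
    · intro n
      have := hT0 n
      positivity
  rw [setLIntegral_congr_fun measurableSet_Ioi hsplit, lintegral_tsum fun n ↦ by fun_prop]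
  have hterm : ∀ n : ℕ, ∫⁻ x in Ioi (0 : ℝ), ENNReal.ofReal (T n) *
        ENNReal.ofReal (x ^ (a + n - 1) * Real.exp (-(p * x))) =
      ENNReal.ofReal ((p ^ (-a) * Real.Gamma a) * (((n.factorial : ℝ)⁻¹ *
        (ascPochhammer ℝ n).eval a * (ascPochhammer ℝ n).eval m *
        ((ascPochhammer ℝ n).eval b)⁻¹) * (y / p) ^ n)) := by
    intro n
    rw [lintegral_const_mul _ (by fun_prop),
      lintegral_rpow_mul_exp_neg_mul_Ioi (by positivity) hp, ← ENNReal.ofReal_mul (hT0 n),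
      Real.Gamma_add_natCast ha, neg_add, Real.rpow_add hp, Real.rpow_neg hp.le (n : ℝ),
      Real.rpow_natCast, div_pow]
    congr 1
    simp only [hT]
    have h2 := (ascPochhammer_pos n _ hb).ne'
    field_simp
  rw [tsum_congr hterm]
  have h := (hasSum_ordinaryHypergeometric ha hm hb (x := y / p) (by positivity)
    ((div_lt_one hp).2 hyp)).mul_left (p ^ (-a) * Real.Gamma a)
  rw [← h.tsum_eq, ENNReal.ofReal_tsum_of_nonneg _ h.summable]
  intro n
  have h1 := ascPochhammer_pos n _ hm
  have h2 := ascPochhammer_pos n _ hb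
  have h3 := ascPochhammer_pos n _ ha
  positivity

/-! ### The κ-μ shadowed law -/

lemma measurable_kappaMuShadowedPDF {μ : ℝ} (hμ : 0 < μ) (κ m w : ℝ) :
    Measurable (kappaMuShadowedPDF μ κ m w) := by
  unfold kappaMuShadowedPDF
  have := measurable_kummerHypergeometric m hμ
  refine Measurable.ite measurableSet_Ioi ?_ measurable_const
  fun_prop

/-- Fractional moments of the exponentially tilted law, by the Laplace transform of `₁F₁`. -/
lemma lintegral_rpow_mul_exp_kappaMuShadowed {μ κ m θ₁ θ₂ δ s : ℝ} (hμ : 0 < μ) (hκ : 0 < κ)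
    (hm : 0 < m) (hθ₁ : θ₁ = 1 / (μ * (1 + κ))) (hθ₂ : θ₂ = (μ * κ + m) / (μ * (1 + κ) * m))
    (hδ : 0 < μ + δ) (hs : 0 ≤ s) :
    ∫⁻ x, ENNReal.ofReal (x ^ δ * Real.exp (-(s * x))) ∂(kappaMuShadowed μ κ m 1) =
      ENNReal.ofReal (θ₁ ^ (m - μ) * θ₂ ^ (-m) / Real.Gamma μ *
        ((s + 1 / θ₁) ^ (-(μ + δ)) * Real.Gamma (μ + δ) *
          ordinaryHypergeometric (μ + δ) m μ ((1 / θ₁ - 1 / θ₂) / (s + 1 / θ₁)))) := by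
  have h1 : 0 < θ₁ := by rw [hθ₁]; positivity
  have h2 : 0 < θ₂ := by rw [hθ₂]; positivity
  have h12 : θ₁ ≤ θ₂ := by
    rw [hθ₁, hθ₂, div_le_div_iff₀ (by positivity) (by positivity)]
    have : 0 < μ * (1 + κ) * (μ * κ) := by positivity
    nlinarith
  have hΓ := Real.Gamma_pos_of_pos hμ
  have hy : 0 ≤ 1 / θ₁ - 1 / θ₂ := sub_nonneg.2 (one_div_le_one_div_of_le h1 h12)
  have hyp : 1 / θ₁ - 1 / θ₂ < s + 1 / θ₁ := by
    have : 0 < 1 / θ₂ := by positivity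
    linarith
  set C := θ₁ ^ (m - μ) * θ₂ ^ (-m) / Real.Gamma μ with hC
  have hC0 : 0 ≤ C := by positivity
  rw [kappaMuShadowed, lintegral_withDensity_eq_lintegral_mul _
    (measurable_kappaMuShadowedPDF hμ κ m 1).ennreal_ofReal (by fun_prop),
    ENNReal.ofReal_mul hC0, ← lintegral_kummerHypergeometric hδ hm hμ hy hyp,
    ← lintegral_const_mul _ (by
      have := measurable_kummerHypergeometric m hμ
      fun_prop), ← lintegral_indicator measurableSet_Ioi]
  refine lintegral_congr fun x ↦ ?_
  by_cases hx : 0 < x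
  · rw [indicator_of_mem (show x ∈ Ioi 0 from hx), Pi.mul_apply, ← ENNReal.ofReal_mul hC0,
      kappaMuShadowedPDF, ← ENNReal.ofReal_mul']
    · congr 1
      simp only [mul_one, ← hθ₁, ← hθ₂, if_pos hx]
      rw [show (θ₂ - θ₁) * x / (θ₁ * θ₂) = (1 / θ₁ - 1 / θ₂) * x by field_simp,
        show μ + δ - 1 = (μ - 1) + δ by ring, Real.rpow_add hx,
        show -((s + 1 / θ₁) * x) = -x / θ₁ + -(s * x) by ring, Real.exp_add, hC,
        Real.rpow_neg h2.le]
      field_simp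
    · positivity
  · rw [indicator_of_notMem (show x ∉ Ioi 0 from hx), Pi.mul_apply, kappaMuShadowedPDF]
    simp [hx]

lemma ae_pos_kappaMuShadowed {μ : ℝ} (hμ : 0 < μ) (κ m : ℝ) :
    ∀ᵐ x ∂(kappaMuShadowed μ κ m 1), 0 < x := by
  rw [kappaMuShadowed, ae_withDensity_iff (measurable_kappaMuShadowedPDF hμ κ m 1).ennreal_ofReal]
  refine Filter.Eventually.of_forall fun x hx ↦ ?_
  by_contra h
  simp [kappaMuShadowedPDF, h] at hx

/-- The Laplace transform, i.e. the tilted moment of order `0`, where `₂F₁` is a binomial series. -/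
lemma mgf_of_hasLaw_kappaMuShadowed {Ω : Type*} [MeasurableSpace Ω] {P : Measure Ω} {X : Ω → ℝ}
    {μ κ m θ₁ θ₂ s : ℝ} (hμ : 0 < μ) (hκ : 0 < κ) (hm : 0 < m) (hθ₁ : θ₁ = 1 / (μ * (1 + κ)))
    (hθ₂ : θ₂ = (μ * κ + m) / (μ * (1 + κ) * m)) (hX : HasLaw X (kappaMuShadowed μ κ m 1) P)
    (hs : 0 ≤ s) :
    mgf X P (-s) = θ₁ ^ (m - μ) * θ₂ ^ (-m) *
      ((s + 1 / θ₁) ^ (-(μ - m)) * (s + 1 / θ₂) ^ (-m)) := by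
  have h1 : 0 < θ₁ := by rw [hθ₁]; positivity
  have h2 : 0 < θ₂ := by rw [hθ₂]; positivity
  have hΓ := (Real.Gamma_pos_of_pos hμ).ne'
  have h12 : 1 / θ₂ ≤ 1 / θ₁ := by
    refine one_div_le_one_div_of_le h1 ?_
    rw [hθ₁, hθ₂, div_le_div_iff₀ (by positivity) (by positivity)]
    have : 0 < μ * (1 + κ) * (μ * κ) := by positivity
    nlinarith
  have hθ₂' : 0 < 1 / θ₂ := by positivity
  have hp : 0 < s + 1 / θ₁ := by positivity
  have hp2 : 0 < s + 1 / θ₂ := by positivity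
  have hq : 1 - (1 / θ₁ - 1 / θ₂) / (s + 1 / θ₁) = (s + 1 / θ₂) / (s + 1 / θ₁) := by
    rw [eq_div_iff hp.ne', sub_mul, div_mul_cancel₀ _ hp.ne']; ring
  have h := lintegral_rpow_mul_exp_kappaMuShadowed (δ := 0) hμ hκ hm hθ₁ hθ₂ (by simpa) hs
  rw [add_zero, ordinaryHypergeometric_binomial hm hμ
    (div_nonneg (sub_nonneg.2 h12) hp.le) ((div_lt_one hp).2 (by linarith)), hq,
    Real.div_rpow hp2.le hp.le, ← hX.map_eq, lintegral_map' (by fun_prop) hX.aemeasurable] at h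
  rw [mgf, integral_eq_lintegral_of_nonneg_ae
    (Filter.Eventually.of_forall fun ω ↦ Real.exp_nonneg _)
    (by have := hX.aemeasurable; fun_prop)]
  simp only [Real.rpow_zero, one_mul, ← neg_mul] at h
  rw [h, ENNReal.toReal_ofReal]
  · rw [neg_sub, Real.rpow_sub hp m μ, Real.rpow_neg hp.le μ, Real.rpow_neg hp.le m]
    field_simp
  · have := Real.Gamma_pos_of_pos hμ
    positivity

lemma ae_pos_of_hasLaw_kappaMuShadowed {Ω : Type*} [MeasurableSpace Ω] {P : Measure Ω}
    {X : Ω → ℝ} {μ κ m : ℝ} (hμ : 0 < μ) (hX : HasLaw X (kappaMuShadowed μ κ m 1) P) :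
    ∀ᵐ ω ∂P, 0 < X ω :=
  (hX.ae_iff (measurableSet_setOfPred.1 measurableSet_Ioi)).2 (ae_pos_kappaMuShadowed hμ κ m)

lemma lintegral_inv_sqrt_of_hasLaw_kappaMuShadowed {Ω : Type*} [MeasurableSpace Ω] {P : Measure Ω}
    {X : Ω → ℝ} {μ κ m θ₁ θ₂ : ℝ} (hμ : 1 / 2 < μ) (hκ : 0 < κ) (hm : 0 < m)
    (hθ₁ : θ₁ = 1 / (μ * (1 + κ))) (hθ₂ : θ₂ = (μ * κ + m) / (μ * (1 + κ) * m))
    (hX : HasLaw X (kappaMuShadowed μ κ m 1) P) :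
    ∫⁻ ω, ENNReal.ofReal (X ω ^ (-(1 / 2) : ℝ)) ∂P = ENNReal.ofReal
      (θ₁ ^ (m - μ) * θ₂ ^ (-m) * θ₁ ^ (μ - 1 / 2) *
        ordinaryHypergeometric (μ - 1 / 2) m μ (μ * κ / (m + μ * κ)) *
        (Real.Gamma (μ - 1 / 2) / Real.Gamma μ)) := by
  have hμ0 : 0 < μ := by linarith
  have h1 : 0 < θ₁ := by rw [hθ₁]; positivity
  have h := lintegral_rpow_mul_exp_kappaMuShadowed (δ := -(1 / 2)) (s := 0) hμ0 hκ hm hθ₁ hθ₂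
    (by linarith) le_rfl
  rw [← hX.map_eq, lintegral_map' (by fun_prop) hX.aemeasurable] at h
  simp only [zero_mul, neg_zero, Real.exp_zero, mul_one, zero_add, ← sub_eq_add_neg] at h
  rw [h, one_div θ₁, Real.inv_rpow h1.le, ← Real.rpow_neg h1.le, neg_neg]
  have e : (θ₁⁻¹ - 1 / θ₂) / θ₁⁻¹ = μ * κ / (m + μ * κ) := by
    rw [hθ₁, hθ₂]
    field_simp
    ring
  rw [e]
  congr 1
  ring

/-! ### Products of power series -/

/-- A product of absolutely convergent series is the sum over all multi-indices. -/
lemma hasSum_prod_apply {ι : Type*} [Fintype ι] (f : ι → ℕ → ℂ)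
    (hf : ∀ i, Summable (f i)) :
    HasSum (fun k : ι → ℕ ↦ ∏ i, f i (k i)) (∏ i, ∑' n, f i n) := by
  have key : ∀ (n : ℕ) (f : Fin n → ℕ → ℂ), (∀ i, Summable (f i)) →
      HasSum (fun k : Fin n → ℕ ↦ ∏ i, f i (k i)) (∏ i, ∑' n, f i n) := by
    intro n
    induction n with
    | zero =>
      intro f _
      simp
    | succ n ih =>
      intro f hf
      have h1 := ih (fun i ↦ f i.succ) fun i ↦ hf i.succ
      have h2 := summable_mul_of_summable_norm (hf 0).norm h1.summable.norm
      have h3 := h2.hasSum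
      rw [← tsum_mul_tsum_of_summable_norm (hf 0).norm h1.summable.norm, h1.tsum_eq,
        ← Fin.prod_univ_succ fun i ↦ ∑' n, f i n] at h3
      rw [← (Fin.consEquiv fun _ ↦ ℕ).hasSum_iff]
      convert! h3 using 2 with p
      simp [Fin.prod_univ_succ, Fin.consEquiv]
  let e := (Fintype.equivFin ι).symm
  have h := key _ (fun j ↦ f (e j)) fun j ↦ hf (e j)
  rw [e.prod_comp fun i ↦ ∑' n, f i n] at h
  rw [← (e.arrowCongr (Equiv.refl ℕ)).hasSum_iff]
  convert! h using 2 with k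
  rw [Function.comp_apply, ← e.prod_comp]
  simp

/-- The image of the binomial series under the Euler operator `x d/dx`. -/
lemma hasSum_natCast_mul_binomial (b : ℂ) {x : ℂ} (hx : ‖x‖ < 1) :
    HasSum (fun n : ℕ ↦ (n : ℂ) * ((ascPochhammer ℂ n).eval b / (n.factorial : ℂ) * x ^ n))
      (b * x / (1 - x) * (1 - x) ^ (-b)) := by
  have h := (Complex.hasSum_one_sub_cpow_neg (b + 1) hx).mul_left (b * x)
  rw [← hasSum_nat_add_iff' 1, Finset.sum_range_one, Nat.cast_zero, zero_mul, sub_zero]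
  have h1 : 1 - x ≠ 0 := by
    intro h0
    rw [← sub_eq_zero.1 h0] at hx
    simp at hx
  have hval : b * x / (1 - x) * (1 - x) ^ (-b) = b * x * (1 - x) ^ (-(b + 1)) := by
    rw [neg_add, ← sub_eq_add_neg, Complex.cpow_sub _ _ h1, Complex.cpow_one]
    ring
  rw [hval]
  convert! h using 2 with n
  · rw [ascPochhammer_succ_left, Polynomial.eval_mul, Polynomial.eval_X, Polynomial.eval_comp,
      Polynomial.eval_add, Polynomial.eval_X, Polynomial.eval_one, Nat.factorial_succ, pow_succ]
    have h2 : ((n : ℂ) + 1) ≠ 0 := by exact_mod_cast n.succ_ne_zero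
    have h3 : (n.factorial : ℂ) ≠ 0 := by exact_mod_cast n.factorial_ne_zero
    push_cast
    field_simp

/-- The factor `(c + t d/dt) ∏ᵢ (1 - t zᵢ)^{-bᵢ}` of the Euler-type integrand of `F_D`, in terms
of `xᵢ = t zᵢ`. -/
def lauricellaKernel {ι : Type*} [Fintype ι] (b : ι → ℂ) (c : ℂ) (x : ι → ℂ) : ℂ :=
  (c + ∑ i, b i * x i / (1 - x i)) * ∏ i, (1 - x i) ^ (-b i)

lemma hasSum_lauricellaKernel {ι : Type*} [Fintype ι] (b : ι → ℂ) (c : ℂ) {x : ι → ℂ}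
    (hx : ∀ i, ‖x i‖ < 1) :
    HasSum (fun k : ι → ℕ ↦ (c + (∑ i, k i : ℕ)) *
      ∏ i, ((ascPochhammer ℂ (k i)).eval (b i) / ((k i).factorial : ℂ) * x i ^ k i))
      (lauricellaKernel b c x) := by
  classical
  set u : ι → ℕ → ℂ := fun i n ↦ (ascPochhammer ℂ n).eval (b i) / (n.factorial : ℂ) * x i ^ n
  have hu : ∀ i, HasSum (u i) ((1 - x i) ^ (-b i)) :=
    fun i ↦ Complex.hasSum_one_sub_cpow_neg (b i) (hx i)
  have hv : ∀ i, HasSum (fun n : ℕ ↦ (n : ℂ) * u i n)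
      (b i * x i / (1 - x i) * (1 - x i) ^ (-b i)) :=
    fun i ↦ hasSum_natCast_mul_binomial (b i) (hx i)
  have h0 := hasSum_prod_apply u fun i ↦ (hu i).summable
  simp only [fun i ↦ (hu i).tsum_eq] at h0
  have h1 : ∀ i, HasSum (fun k : ι → ℕ ↦ (k i : ℂ) * ∏ j, u j (k j))
      (b i * x i / (1 - x i) * ∏ j, (1 - x j) ^ (-b j)) := by
    intro i
    -- The factor `kᵢ` is absorbed into the `i`-th series only, so that a product is left.
    have hg : ∀ j, HasSum (fun n : ℕ ↦ (if j = i then (n : ℂ) else 1) * u j n)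
        ((if j = i then b j * x j / (1 - x j) else 1) * (1 - x j) ^ (-b j)) := by
      intro j
      by_cases h : j = i
      · simpa only [if_pos h] using hv j
      · simpa only [if_neg h, one_mul] using hu j
    have h := hasSum_prod_apply _ fun j ↦ (hg j).summable
    simp only [fun j ↦ (hg j).tsum_eq] at h
    simpa only [Finset.prod_mul_distrib, Finset.prod_ite_eq', Finset.mem_univ, if_true] using h
  have h2 := (h0.mul_left c).add (hasSum_sum fun i (_ : i ∈ Finset.univ) ↦ h1 i)
  convert! h2 using 2 with k
  · rw [← Finset.sum_mul, ← add_mul]; push_cast; rfl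
  · rw [← Finset.sum_mul, ← add_mul]; rfl

/-! ### Euler-type integral for Lauricella's function: the series -/

lemma lintegral_betaWeight {u v : ℝ} (hu : 0 < u) (hv : 0 < v) :
    ∫⁻ t in Ioo (0 : ℝ) 1, ENNReal.ofReal (t ^ (u - 1) * (1 - t) ^ (v - 1)) =
      ENNReal.ofReal (beta u v) := by
  have hB := beta_pos hu hv
  have h := lintegral_betaPDF_eq_one hu hv
  rw [lintegral_betaPDF] at h
  have h2 : ∫⁻ t in Ioo (0 : ℝ) 1, ENNReal.ofReal (1 / beta u v * t ^ (u - 1) * (1 - t) ^ (v - 1))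
      = ENNReal.ofReal (1 / beta u v) *
        ∫⁻ t in Ioo (0 : ℝ) 1, ENNReal.ofReal (t ^ (u - 1) * (1 - t) ^ (v - 1)) := by
    rw [← lintegral_const_mul _ (by fun_prop)]
    refine lintegral_congr fun t ↦ ?_
    rw [mul_assoc, ENNReal.ofReal_mul (by positivity)]
  rw [h2] at h
  calc _ = ENNReal.ofReal (beta u v) * (ENNReal.ofReal (1 / beta u v) *
        ∫⁻ t in Ioo (0 : ℝ) 1, ENNReal.ofReal (t ^ (u - 1) * (1 - t) ^ (v - 1))) := by
        rw [← mul_assoc, ← ENNReal.ofReal_mul hB.le, mul_one_div_cancel hB.ne', ENNReal.ofReal_one,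
          one_mul]
    _ = _ := by rw [h, mul_one]

lemma betaWeight_nonneg (u v : ℝ) :
    ∀ᵐ t ∂volume.restrict (Ioo (0 : ℝ) 1), 0 ≤ t ^ (u - 1) * (1 - t) ^ (v - 1) := by
  filter_upwards [ae_restrict_mem measurableSet_Ioo] with t ht
  have h1 := ht.1
  have h2 := sub_pos.2 ht.2
  positivity

lemma integrableOn_betaWeight {u v : ℝ} (hu : 0 < u) (hv : 0 < v) :
    IntegrableOn (fun t : ℝ ↦ t ^ (u - 1) * (1 - t) ^ (v - 1)) (Ioo 0 1) := by
  refine ⟨by fun_prop, ?_⟩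
  rw [hasFiniteIntegral_iff_ofReal (betaWeight_nonneg u v), lintegral_betaWeight hu hv]
  exact ENNReal.ofReal_lt_top

lemma integral_betaWeight {u v : ℝ} (hu : 0 < u) (hv : 0 < v) :
    ∫ t in Ioo (0 : ℝ) 1, t ^ (u - 1) * (1 - t) ^ (v - 1) = beta u v := by
  rw [integral_eq_lintegral_of_nonneg_ae (betaWeight_nonneg u v) (by fun_prop),
    lintegral_betaWeight hu hv, ENNReal.toReal_ofReal (beta_pos hu hv).le]

/-- The moments of the weight `t^(u-1) (1-t)^(v-1)`, with their convergence. -/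
lemma integral_betaWeight_mul_pow {u v : ℝ} (hu : 0 < u) (hv : 0 < v) (N : ℕ) :
    IntegrableOn (fun t : ℝ ↦ t ^ (u - 1) * (1 - t) ^ (v - 1) * t ^ N) (Ioo 0 1) ∧
    ∫ t in Ioo (0 : ℝ) 1, t ^ (u - 1) * (1 - t) ^ (v - 1) * t ^ N = beta (u + N) v := by
  have huN : 0 < u + N := by positivity
  have h : EqOn (fun t : ℝ ↦ t ^ (u + N - 1) * (1 - t) ^ (v - 1))
      (fun t : ℝ ↦ t ^ (u - 1) * (1 - t) ^ (v - 1) * t ^ N) (Ioo 0 1) := by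
    intro t ht
    simp only
    rw [add_sub_right_comm, Real.rpow_add_natCast ht.1.ne']
    ring
  exact ⟨(integrableOn_betaWeight huN hv).congr_fun h measurableSet_Ioo, by
    rw [← setIntegral_congr_fun measurableSet_Ioo h, integral_betaWeight huN hv]⟩

/-- An Euler-type integral for `F_D(a, b; c; z)`, valid for `0 < a < c + 1`: the usual integral
for `F_D(a, b; c + 1; z)`, to which the operator `(c + ∑ zᵢ ∂ᵢ) / c` that lowers `c + 1` to `c`
has been applied. -/
def lauricellaEuler {ι : Type*} [Fintype ι] (a : ℝ) (b : ι → ℂ) (c : ℝ) (z : ι → ℂ) : ℂ :=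
  ((Real.Gamma c / (Real.Gamma a * Real.Gamma (c + 1 - a)) : ℝ) : ℂ) *
    ∫ t in Ioo (0 : ℝ) 1, ((t ^ (a - 1) * (1 - t) ^ (c + 1 - a - 1) : ℝ) : ℂ) *
      lauricellaKernel b c fun i ↦ z i * t

lemma hasSum_lauricellaEuler {ι : Type*} [Fintype ι] {a c : ℝ} (b : ι → ℂ) (ha : 0 < a)
    (hc : 0 < c) (hac : a < c + 1) {z : ι → ℂ} (hz : ∀ i, ‖z i‖ < 1) :
    HasSum (lauricellaFDTerm a b c z) (lauricellaEuler a b c z) := by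
  have hv : 0 < c + 1 - a := by linarith
  set C : (ι → ℕ) → ℂ := fun k ↦ (c + (∑ i, k i : ℕ)) *
      ∏ i, ((ascPochhammer ℂ (k i)).eval (b i) / ((k i).factorial : ℂ) * z i ^ k i) with hC
  have hCs : Summable C := (hasSum_lauricellaKernel b c hz).summable
  set w : ℝ → ℝ := fun t ↦ t ^ (a - 1) * (1 - t) ^ (c + 1 - a - 1) with hw
  have hint := fun N : ℕ ↦ integral_betaWeight_mul_pow ha hv N
  set F : (ι → ℕ) → ℝ → ℂ := fun k t ↦ C k * ((w t * t ^ (∑ i, k i) : ℝ) : ℂ) with hF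
  have hFint : ∀ k, Integrable (F k) (volume.restrict (Ioo (0 : ℝ) 1)) := fun k ↦
    ((hint (∑ i, k i)).1.ofReal).const_mul (C k)
  have hFnorm : ∀ k, ∫ t in Ioo (0 : ℝ) 1, ‖F k t‖ ≤ ‖C k‖ * beta a (c + 1 - a) := by
    intro k
    rw [← integral_betaWeight ha hv, ← integral_const_mul]
    refine setIntegral_mono_on (hFint k).norm ((integrableOn_betaWeight ha hv).const_mul _)
      measurableSet_Ioo fun t ht ↦ ?_
    have h1 := ht.1
    have h2 := sub_pos.2 ht.2
    have h3 : 0 ≤ w t := by simp only [hw]; positivity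
    rw [hF, norm_mul, Complex.norm_real, Real.norm_of_nonneg (by positivity)]
    refine mul_le_mul_of_nonneg_left ?_ (norm_nonneg _)
    exact mul_le_of_le_one_right h3 (pow_le_one₀ h1.le ht.2.le)
  -- Termwise integration: the `L¹` norms are dominated by the kernel's series at `t = 1`.
  have hsum := hasSum_integral_of_summable_integral_norm hFint
    (Summable.of_nonneg_of_le (fun k ↦ integral_nonneg fun t ↦ norm_nonneg _) hFnorm
      (hCs.norm.mul_right _))
  have hpt : ∫ t in Ioo (0 : ℝ) 1, ∑' k, F k t = ∫ t in Ioo (0 : ℝ) 1, (w t : ℂ) *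
      lauricellaKernel b c fun i ↦ z i * t := by
    refine setIntegral_congr_fun measurableSet_Ioo fun t ht ↦ ?_
    have hzt : ∀ i, ‖z i * t‖ < 1 := fun i ↦ by
      rw [norm_mul, Complex.norm_real, Real.norm_of_nonneg ht.1.le]
      exact mul_lt_one_of_nonneg_of_lt_one_left (norm_nonneg _) (hz i) ht.2.le
    have h := (hasSum_lauricellaKernel b c hzt).mul_left (w t : ℂ)
    refine (Eq.symm ?_).trans h.tsum_eq
    refine tsum_congr fun k ↦ ?_
    simp only [hF, hC, mul_pow, Finset.prod_mul_distrib, Finset.prod_pow_eq_pow_sum]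
    push_cast
    ring
  rw [hpt] at hsum
  have h := hsum.mul_left ((Real.Gamma c / (Real.Gamma a * Real.Gamma (c + 1 - a)) : ℝ) : ℂ)
  convert! h using 2 with k
  -- The factor `c + |k|` turns `Γ(c + 1 + |k|)`, from the beta integral, into `Γ(c + |k|)`.
  rw [hF, integral_const_mul, integral_complex_ofReal, (hint _).2, beta, lauricellaFDTerm,
    ascPochhammer_eval_ofReal, ascPochhammer_eval_ofReal, Real.Gamma_add_natCast ha,
    show a + (∑ i, k i : ℕ) + (c + 1 - a) = (c + (∑ i, k i : ℕ)) + 1 by ring,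
    Real.Gamma_add_one (by positivity), Real.Gamma_add_natCast hc]
  have g1 := (Real.Gamma_pos_of_pos ha).ne'
  have g2 := (Real.Gamma_pos_of_pos hc).ne'
  have g3 := (Real.Gamma_pos_of_pos hv).ne'
  have g4 := (ascPochhammer_pos (∑ i, k i) c hc).ne'
  have g5 : (c : ℂ) + (∑ i, k i : ℕ) ≠ 0 := by
    have : c + (∑ i, k i : ℕ) ≠ 0 := by positivity
    exact_mod_cast this
  simp only [hC]
  generalize (∑ i, k i : ℕ) = N at *
  push_cast
  have g1' : (Real.Gamma a : ℂ) ≠ 0 := by exact_mod_cast g1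
  have g2' : (Real.Gamma c : ℂ) ≠ 0 := by exact_mod_cast g2
  have g3' : (Real.Gamma (c + 1 - a) : ℂ) ≠ 0 := by exact_mod_cast g3
  have g4' : ((Polynomial.eval c (ascPochhammer ℝ N) : ℝ) : ℂ) ≠ 0 := by exact_mod_cast g4
  field_simp

/-! ### Euler-type integral for Lauricella's function: analyticity -/

/-- A family of continuous functions on a compact space which is pointwise holomorphic in the
parameter, with jointly continuous derivative, is analytic for the supremum norm. -/
lemma analyticOnNhd_mkD {X : Type*} [TopologicalSpace X] [CompactSpace X] {U : Set ℂ}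
    (hU : IsOpen U) {f f' : ℂ → X → ℂ}
    (hd : ∀ z ∈ U, ∀ x, HasDerivAt (fun w ↦ f w x) (f' z x) z)
    (hf : ContinuousOn (Function.uncurry f) (U ×ˢ univ))
    (hf' : ContinuousOn (Function.uncurry f') (U ×ˢ univ)) :
    AnalyticOnNhd ℂ (fun z ↦ ContinuousMap.mkD (f z) 0) U := by
  have hfz : ∀ z ∈ U, Continuous (f z) := fun z hz ↦
    hf.comp_continuous (Continuous.prodMk_right z) fun _ ↦ ⟨hz, trivial⟩
  have hfz' : ∀ z ∈ U, Continuous (f' z) := fun z hz ↦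
    hf'.comp_continuous (Continuous.prodMk_right z) fun _ ↦ ⟨hz, trivial⟩
  have hcont := ContinuousMap.continuousOn_mkD_of_uncurry f' 0 hf'
  refine DifferentiableOn.analyticOnNhd (fun z₀ hz₀ ↦ ?_) hU
  refine (HasDerivAt.differentiableAt (f' := ContinuousMap.mkD (f' z₀) 0)
    ?_).differentiableWithinAt
  rw [hasDerivAt_iff_isLittleO, Asymptotics.isLittleO_iff]
  intro ε hε
  have hev := ((hcont.continuousAt (hU.mem_nhds hz₀)).eventually
    (Metric.closedBall_mem_nhds _ hε)).and (hU.mem_nhds hz₀)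
  obtain ⟨δ, hδ, hball⟩ := Metric.eventually_nhds_iff_ball.1 hev
  filter_upwards [Metric.ball_mem_nhds z₀ hδ] with z hz
  refine (ContinuousMap.norm_le _ (by positivity)).2 fun x ↦ ?_
  have hbd : ∀ w ∈ Metric.ball z₀ δ, ‖f' w x - f' z₀ x‖ ≤ ε := by
    intro w hw
    have h := (hball w hw).1
    have h2 := (ContinuousMap.mkD (f' w) 0).dist_apply_le_dist (g := ContinuousMap.mkD (f' z₀) 0) x
    rw [ContinuousMap.mkD_apply_of_continuous (hfz' w (hball w hw).2),
      ContinuousMap.mkD_apply_of_continuous (hfz' z₀ hz₀), dist_eq_norm] at h2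
    exact h2.trans h
  -- The mean value inequality for `w ↦ f w x - w f' z₀ x`, with a bound independent of `x`.
  have hmv := (convex_ball z₀ δ).norm_image_sub_le_of_norm_hasDerivWithin_le
    (f := fun w ↦ f w x - w * f' z₀ x) (f' := fun w ↦ f' w x - f' z₀ x)
    (fun w hw ↦ by
      have := (hd w (hball w hw).2 x).sub ((hasDerivAt_id w).mul_const (f' z₀ x))
      simp only [one_mul] at this
      exact this.hasDerivWithinAt) hbd (Metric.mem_ball_self hδ) hz
  convert! hmv using 2
  simp only [ContinuousMap.sub_apply, ContinuousMap.smul_apply,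
    ContinuousMap.mkD_apply_of_continuous (hfz' z₀ hz₀), ContinuousMap.mkD_apply_of_continuous
    (hfz z₀ hz₀), ContinuousMap.mkD_apply_of_continuous (hfz z (hball z hz).2), smul_eq_mul]
  ring

lemma one_sub_mul_mem_slitPlane {z : ℂ} (hz : 1 - z ∈ Complex.slitPlane) {t : ℝ}
    (ht : t ∈ Icc (0 : ℝ) 1) : 1 - z * t ∈ Complex.slitPlane := by
  have h := Complex.starConvex_one_slitPlane hz (sub_nonneg.2 ht.2) ht.1 (sub_add_cancel 1 t)
  convert! h using 1
  simp only [Complex.real_smul]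
  push_cast
  ring

lemma isOpen_one_sub_mem_slitPlane : IsOpen {z : ℂ | 1 - z ∈ Complex.slitPlane} :=
  Complex.isOpen_slitPlane.preimage (by fun_prop)

lemma continuousOn_one_sub_mul_cpow (b : ℂ) :
    ContinuousOn (fun p : ℂ × Icc (0 : ℝ) 1 ↦ (1 - p.1 * (p.2 : ℝ)) ^ b)
      ({z : ℂ | 1 - z ∈ Complex.slitPlane} ×ˢ univ) :=
  ContinuousOn.cpow_const (by fun_prop) fun p hp ↦ one_sub_mul_mem_slitPlane hp.1 p.2.2

/-- The function `t ↦ (1 - z t) ^ b` as an element of the Banach algebra `C([0, 1], ℂ)`, for `z`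
off the cut `[1, ∞)`. For `z` on the cut the value is the junk default `0` of `mkD`, unless the
function happens to be continuous. -/
def oneSubMulCpow (b z : ℂ) : C(Icc (0 : ℝ) 1, ℂ) :=
  ContinuousMap.mkD (fun t : Icc (0 : ℝ) 1 ↦ (1 - z * (t : ℝ)) ^ b) 0

lemma oneSubMulCpow_apply (b : ℂ) {z : ℂ} (hz : 1 - z ∈ Complex.slitPlane) (t : Icc (0 : ℝ) 1) :
    oneSubMulCpow b z t = (1 - z * (t : ℝ)) ^ b :=
  ContinuousMap.mkD_apply_of_continuous <| (continuousOn_one_sub_mul_cpow b).comp_continuous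
    (Continuous.prodMk_right z) fun _ ↦ ⟨hz, trivial⟩

lemma analyticOnNhd_oneSubMulCpow (b : ℂ) :
    AnalyticOnNhd ℂ (oneSubMulCpow b) {z : ℂ | 1 - z ∈ Complex.slitPlane} := by
  refine analyticOnNhd_mkD isOpen_one_sub_mem_slitPlane
    (f' := fun z t ↦ b * (1 - z * (t : ℝ)) ^ (b - 1) * (-(t : ℝ))) (fun z hz t ↦ ?_)
    (continuousOn_one_sub_mul_cpow b) ?_
  · have h := (((hasDerivAt_id z).mul_const ((t : ℝ) : ℂ)).const_sub 1).cpow_const (c := b)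
      (one_sub_mul_mem_slitPlane hz t.2)
    simpa using h
  · exact (continuousOn_const.mul (continuousOn_one_sub_mul_cpow (b - 1))).mul (by fun_prop)

/-- Integration against an integrable weight on `(0, 1)`, as a continuous functional on
`C([0, 1], ℂ)`. -/
def integralWeightCLM (w : ℝ → ℝ) (hw : IntegrableOn w (Ioo 0 1)) :
    C(Icc (0 : ℝ) 1, ℂ) →L[ℂ] ℂ :=
  have hint : ∀ g : C(Icc (0 : ℝ) 1, ℂ),
      IntegrableOn (fun t ↦ (w t : ℂ) * g (projIcc 0 1 zero_le_one t)) (Ioo 0 1) := fun g ↦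
    (Integrable.ofReal hw).mul_bdd (c := ‖g‖) (g.continuous.comp continuous_projIcc).aestronglyMeasurable
      (Filter.Eventually.of_forall fun t ↦ g.norm_coe_le_norm _)
  LinearMap.mkContinuous
    { toFun := fun g ↦ ∫ t in Ioo (0 : ℝ) 1, (w t : ℂ) * g (projIcc 0 1 zero_le_one t)
      map_add' := fun g h ↦ by
        simp only [ContinuousMap.add_apply, mul_add]
        exact integral_add (hint g) (hint h)
      map_smul' := fun r g ↦ by
        simp only [ContinuousMap.smul_apply, smul_eq_mul, RingHom.id_apply]
        rw [← integral_const_mul]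
        exact integral_congr_ae (Filter.Eventually.of_forall fun t ↦ by ring) }
    (∫ t in Ioo (0 : ℝ) 1, ‖w t‖) fun g ↦ by
      rw [← integral_mul_const]
      refine norm_integral_le_of_norm_le (Integrable.mul_const hw.norm _)
        (Filter.Eventually.of_forall fun t ↦ ?_)
      rw [norm_mul, Complex.norm_real]
      exact mul_le_mul_of_nonneg_left (g.norm_coe_le_norm _) (norm_nonneg _)

lemma analyticOnNhd_lauricellaEuler {ι : Type*} [Fintype ι] {a c : ℝ} (b : ι → ℂ) (ha : 0 < a)
    (hac : a < c + 1) : AnalyticOnNhd ℂ (lauricellaEuler a b c) (lauricellaFDDomain ι) := by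
  have hv : 0 < c + 1 - a := by linarith
  -- `G z` is the kernel as an element of `C([0, 1], ℂ)`; `1 / (1 - z t)` is the power `-1`.
  let τ : C(Icc (0 : ℝ) 1, ℂ) := ⟨fun t ↦ ((t : ℝ) : ℂ), by fun_prop⟩
  let G : (ι → ℂ) → C(Icc (0 : ℝ) 1, ℂ) := fun z ↦
    (algebraMap ℂ _ (c : ℂ) + ∑ i, (b i * z i) • (τ * oneSubMulCpow (-1) (z i))) *
      ∏ i, oneSubMulCpow (-b i) (z i)
  have hcoord : ∀ i, AnalyticOnNhd ℂ (fun z : ι → ℂ ↦ z i) (lauricellaFDDomain ι) := fun i ↦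
    (ContinuousLinearMap.proj (R := ℂ) (φ := fun _ : ι ↦ ℂ) i).analyticOnNhd _
  have hφ : ∀ (β : ℂ) i, AnalyticOnNhd ℂ (fun z : ι → ℂ ↦ oneSubMulCpow β (z i))
      (lauricellaFDDomain ι) := fun β i ↦
    (analyticOnNhd_oneSubMulCpow β).comp (hcoord i) fun z hz ↦ hz i
  have hG : AnalyticOnNhd ℂ G (lauricellaFDDomain ι) := by
    refine (analyticOnNhd_const.add (Finset.analyticOnNhd_fun_sum _ fun i _ ↦ ?_)).mul
      (Finset.analyticOnNhd_fun_prod _ fun i _ ↦ hφ _ i)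
    exact (analyticOnNhd_const.mul (hcoord i)).smul (analyticOnNhd_const.mul (hφ _ i))
  have hopen : IsOpen (lauricellaFDDomain ι) := by
    have : lauricellaFDDomain ι = ⋂ i, (fun z : ι → ℂ ↦ z i) ⁻¹'
        {z : ℂ | 1 - z ∈ Complex.slitPlane} := by
      ext z; simp [lauricellaFDDomain]
    rw [this]
    exact isOpen_iInter_of_finite fun i ↦ isOpen_one_sub_mem_slitPlane.preimage (by fun_prop)
  set L := integralWeightCLM _ (integrableOn_betaWeight ha hv)
  have hLG : AnalyticOnNhd ℂ (fun z ↦ L (G z)) (lauricellaFDDomain ι) :=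
    (L.analyticOnNhd univ).comp hG fun _ _ ↦ trivial
  refine ((analyticOnNhd_const (v :=
    ((Real.Gamma c / (Real.Gamma a * Real.Gamma (c + 1 - a)) : ℝ) : ℂ))).mul hLG).congr
    hopen fun z hz ↦ ?_
  rw [lauricellaEuler]
  congr 1
  refine setIntegral_congr_fun measurableSet_Ioo fun t ht ↦ ?_
  have ht' : t ∈ Icc (0 : ℝ) 1 := Ioo_subset_Icc_self ht
  simp only [projIcc_of_mem zero_le_one ht']
  congr 1
  simp only [G, lauricellaKernel, ContinuousMap.mul_apply, ContinuousMap.add_apply,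
    ContinuousMap.sum_apply, ContinuousMap.prod_apply, ContinuousMap.smul_apply, smul_eq_mul,
    fun β i ↦ oneSubMulCpow_apply β (hz i), Complex.cpow_neg_one]
  congr 1
  congr 1
  refine Finset.sum_congr rfl fun i _ ↦ ?_
  simp only [τ, ContinuousMap.coe_mk, div_eq_mul_inv]
  ring

/-- The Euler-type integral is the principal branch of `F_D`. -/
lemma isLauricellaFD_lauricellaEuler {ι : Type*} [Fintype ι] {a c : ℝ} (b : ι → ℂ) (ha : 0 < a)
    (hc : 0 < c) (hac : a < c + 1) : IsLauricellaFD a b c (lauricellaEuler a b c) :=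
  ⟨analyticOnNhd_lauricellaEuler b ha hac, fun _ hz ↦ hasSum_lauricellaEuler b ha hc hac hz⟩

lemma IsLauricellaFD.lauricellaFD {ι : Type*} [Fintype ι] {a c : ℂ} {b : ι → ℂ}
    {F : (ι → ℂ) → ℂ} (hF : IsLauricellaFD a b c F) : IsLauricellaFD a b c (lauricellaFD a b c) := by
  have h : ∃ F, IsLauricellaFD a b c F := ⟨F, hF⟩
  rw [_root_.lauricellaFD, dif_pos h]
  exact h.choose_spec

/-! ### The half moment from the Laplace transform -/

lemma mem_interior_integrableExpSet_of_ae_nonneg {Ω : Type*} [MeasurableSpace Ω] {P : Measure Ω}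
    [IsFiniteMeasure P] {X : Ω → ℝ} (hX : AEMeasurable X P) (h0 : ∀ᵐ ω ∂P, 0 ≤ X ω) {s : ℝ}
    (hs : 0 < s) : -s ∈ interior (integrableExpSet X P) := by
  refine interior_maximal (s := integrableExpSet X P) (fun t (ht : t < 0) ↦ ?_) isOpen_Iio
    (neg_lt_zero.2 hs)
  refine Integrable.of_bound (by fun_prop) 1 ?_
  filter_upwards [h0] with ω hω
  rw [Real.norm_of_nonneg (Real.exp_nonneg _), Real.exp_le_one_iff]
  exact mul_nonpos_of_nonpos_of_nonneg ht.le hω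

/-- `E[√X]` as a Mellin-type integral of the derivative of the moment generating function, obtained
by averaging `√x = Γ(1/2)⁻¹ ∫₀^∞ s^{-1/2} x e^{-s x} ds`. -/
lemma lintegral_sqrt_eq_lintegral_deriv_mgf {Ω : Type*} [MeasurableSpace Ω] {P : Measure Ω}
    [IsFiniteMeasure P] {X : Ω → ℝ} (hX : AEMeasurable X P) (h0 : ∀ᵐ ω ∂P, 0 < X ω) :
    ∫⁻ ω, ENNReal.ofReal √(X ω) ∂P = ∫⁻ s in Ioi (0 : ℝ), ENNReal.ofReal
      (s ^ (-(1 / 2) : ℝ) / Real.Gamma (1 / 2) * deriv (mgf X P) (-s)) := by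
  have hΓ : 0 < Real.Gamma (1 / 2) := Real.Gamma_pos_of_pos (by norm_num)
  have hpt : ∀ᵐ ω ∂P, ENNReal.ofReal √(X ω) = ∫⁻ s in Ioi (0 : ℝ),
      ENNReal.ofReal (s ^ (-(1 / 2) : ℝ) / Real.Gamma (1 / 2)) *
        ENNReal.ofReal (X ω * Real.exp (-s * X ω)) := by
    filter_upwards [h0] with ω hω
    have h := lintegral_rpow_mul_exp_neg_mul_Ioi (a := 1 / 2) (by norm_num) hω
    have h2 : ∀ s ∈ Ioi (0 : ℝ), ENNReal.ofReal (s ^ (-(1 / 2) : ℝ) / Real.Gamma (1 / 2)) *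
        ENNReal.ofReal (X ω * Real.exp (-s * X ω)) = ENNReal.ofReal (X ω / Real.Gamma (1 / 2)) *
        ENNReal.ofReal (s ^ ((1 / 2 : ℝ) - 1) * Real.exp (-(X ω * s))) := by
      intro s hs
      have hs : 0 < s := hs
      rw [← ENNReal.ofReal_mul (by positivity), ← ENNReal.ofReal_mul (by positivity)]
      congr 1
      rw [show (1 / 2 : ℝ) - 1 = -(1 / 2) by norm_num, show -(X ω * s) = -s * X ω by ring]
      ring
    rw [setLIntegral_congr_fun measurableSet_Ioi h2, lintegral_const_mul _ (by fun_prop), h,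
      ← ENNReal.ofReal_mul (by positivity)]
    congr 1
    have h3 : X ω * X ω ^ (-(1 / 2) : ℝ) = √(X ω) := by
      rw [Real.sqrt_eq_rpow, ← Real.rpow_one_add' hω.le (by norm_num)]
      norm_num
    rw [← h3]
    field_simp
  rw [lintegral_congr_ae hpt, lintegral_lintegral_swap]
  · refine setLIntegral_congr_fun measurableSet_Ioi fun s hs ↦ ?_
    have hs : 0 < s := hs
    have hmem := mem_interior_integrableExpSet_of_ae_nonneg hX (h0.mono fun _ h ↦ h.le) hs
    rw [lintegral_const_mul'' _ (by fun_prop), deriv_mgf hmem, ENNReal.ofReal_mul (by positivity),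
      ofReal_integral_eq_lintegral_ofReal]
    · simpa using integrable_pow_mul_exp_of_mem_interior_integrableExpSet hmem 1
    · filter_upwards [h0] with ω hω
      exact mul_nonneg hω.le (Real.exp_nonneg _)
  · have hX1 : AEMeasurable (fun p : Ω × ℝ ↦ X p.1)
        (P.prod (volume.restrict (Ioi (0 : ℝ)))) :=
      hX.comp_quasiMeasurePreserving Measure.quasiMeasurePreserving_fst
    unfold Function.uncurry
    fun_prop

lemma hasDerivAt_prod_sub_rpow_neg {ι : Type*} [Fintype ι] {l β : ι → ℝ} {t : ℝ}
    (h : ∀ j, 0 < l j - t) :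
    HasDerivAt (fun t ↦ ∏ j, (l j - t) ^ (-β j))
      ((∏ j, (l j - t) ^ (-β j)) * ∑ j, β j / (l j - t)) t := by
  classical
  have h1 : ∀ j ∈ Finset.univ, HasDerivAt (fun t ↦ (l j - t) ^ (-β j))
      ((l j - t) ^ (-β j) * (β j / (l j - t))) t := by
    intro j _
    have := ((hasDerivAt_id t).const_sub (l j)).rpow_const (p := -β j) (Or.inl (h j).ne')
    convert! this using 1
    simp only [id]
    rw [Real.rpow_sub_one (h j).ne']
    ring
  have h2 := HasDerivAt.fun_finsetProd h1
  convert! h2 using 1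
  rw [Finset.mul_sum]
  refine Finset.sum_congr rfl fun j hj ↦ ?_
  rw [smul_eq_mul, ← mul_assoc, Finset.prod_erase_mul _ _ hj]

/-- If the Laplace transform of `X > 0` is a product of powers `(s + lⱼ)^{-βⱼ}`, then `E[√X]` is an
Euler-type integral with the kernel of `F_D`; the substitution is `s = Λ (1 - t) / t`. -/
lemma lintegral_sqrt_of_mgf_eq_prod {Ω : Type*} [MeasurableSpace Ω] {P : Measure Ω}
    [IsFiniteMeasure P] {X : Ω → ℝ} (hX : AEMeasurable X P) (h0 : ∀ᵐ ω ∂P, 0 < X ω)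
    {ι : Type*} [Fintype ι] {l β : ι → ℝ} {C Λ c : ℝ} (hC : 0 < C) (hl : ∀ j, 0 < l j)
    (hΛ : 0 < Λ) (hc : 0 < c) (hβ : ∑ j, β j = c)
    (hM : ∀ s, 0 < s → mgf X P (-s) = C * ∏ j, (s + l j) ^ (-β j)) :
    ∃ J : ℝ, 0 ≤ J ∧
      (J : ℂ) = ∫ t in Ioo (0 : ℝ) 1, ((t ^ (c + 1 / 2 - 1) * (1 - t) ^ (1 / 2 - 1 : ℝ) : ℝ) : ℂ) *
        lauricellaKernel (fun j ↦ (β j : ℂ)) c (fun j ↦ ((1 - l j / Λ : ℝ) : ℂ) * t) ∧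
      ∫⁻ ω, ENNReal.ofReal √(X ω) ∂P =
        ENNReal.ofReal (C * Λ ^ (-(c + 1 / 2)) / Real.Gamma (1 / 2) * J) := by
  have hΓ : 0 < Real.Gamma (1 / 2) := Real.Gamma_pos_of_pos (by norm_num)
  set K : ℝ := C * Λ ^ (-(c + 1 / 2)) / Real.Gamma (1 / 2) with hK
  have hK0 : 0 < K := by positivity
  set z : ι → ℝ := fun j ↦ 1 - l j / Λ with hz
  set w : ℝ → ℝ := fun t ↦ t ^ (c + 1 / 2 - 1) * (1 - t) ^ (1 / 2 - 1 : ℝ) with hw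
  set kR : ℝ → ℝ := fun t ↦ (c + ∑ j, β j * (z j * t) / (1 - z j * t)) *
    ∏ j, (1 - z j * t) ^ (-β j) with hkR
  have hx : ∀ t ∈ Icc (0 : ℝ) 1, ∀ j, 0 < 1 - z j * t := by
    intro t ht j
    have h1 : 0 < l j / Λ := div_pos (hl j) hΛ
    have h2 : 1 - z j * t = (1 - t) + t * (l j / Λ) := by simp only [hz]; ring
    rw [h2]
    rcases ht.1.eq_or_lt with h | h
    · rw [← h]; norm_num
    · have := mul_pos h h1
      linarith [ht.2]
  have hkcont : ContinuousOn kR (Icc 0 1) := by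
    refine ContinuousOn.mul (continuousOn_const.add (continuousOn_finsetSum _ fun j _ ↦ ?_))
      (continuousOn_finsetProd _ fun j _ ↦ ?_)
    · exact ContinuousOn.div (by fun_prop) (by fun_prop) fun t ht ↦ (hx t ht j).ne'
    · exact ContinuousOn.rpow_const (by fun_prop) fun t ht ↦ Or.inl (hx t ht j).ne'
  have hwint : IntegrableOn (fun t ↦ w t * kR t) (Ioo 0 1) :=
    (integrableOn_betaWeight (by positivity) (by norm_num)).mul_continuousOn_of_subset hkcont
      measurableSet_Ioo isCompact_Icc Ioo_subset_Icc_self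
  have hderiv : ∀ s, 0 < s → deriv (mgf X P) (-s) =
      C * ((∏ j, (s + l j) ^ (-β j)) * ∑ j, β j / (s + l j)) := by
    intro s hs
    have h := (hasDerivAt_prod_sub_rpow_neg (β := β) (l := l) (t := -s)
      (fun j ↦ by linarith [hl j])).const_mul C
    have hev : mgf X P =ᶠ[nhds (-s)] fun t ↦ C * ∏ j, (l j - t) ^ (-β j) := by
      filter_upwards [Iio_mem_nhds (neg_lt_zero.2 hs)] with t ht
      have := hM (-t) (neg_pos.2 ht)
      rw [neg_neg] at this
      rw [this]
      simp only [neg_add_eq_sub]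
    rw [(h.congr_of_eventuallyEq hev).deriv]
    simp only [sub_neg_eq_add, add_comm s]
  have hderiv0 : ∀ s, 0 < s → 0 ≤ deriv (mgf X P) (-s) := by
    intro s hs
    rw [deriv_mgf (mem_interior_integrableExpSet_of_ae_nonneg hX (h0.mono fun _ h ↦ h.le) hs)]
    refine integral_nonneg_of_ae ?_
    filter_upwards [h0] with ω hω
    exact mul_nonneg hω.le (Real.exp_nonneg _)
  set φ : ℝ → ℝ := fun t ↦ Λ * (1 - t) / t with hφ
  have hφpos : ∀ t ∈ Ioo (0 : ℝ) 1, 0 < φ t := fun t ht ↦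
    div_pos (mul_pos hΛ (sub_pos.2 ht.2)) ht.1
  have hφimg : φ '' Ioo 0 1 = Ioi 0 := by
    ext s
    constructor
    · rintro ⟨t, ht, rfl⟩
      exact hφpos t ht
    · intro hs
      have hs : 0 < s := hs
      refine ⟨Λ / (s + Λ), ⟨by positivity, (div_lt_one (by positivity)).2 (by linarith)⟩, ?_⟩
      simp only [hφ]
      field_simp
      ring
  have hφinj : InjOn φ (Ioo 0 1) := by
    intro t ht u hu h
    have h1 := ht.1.ne'
    have h2 := hu.1.ne'
    simp only [hφ] at h
    field_simp at h
    linarith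
  have hφd : ∀ t ∈ Ioo (0 : ℝ) 1, HasDerivWithinAt φ (-(Λ / t ^ 2)) (Ioo 0 1) t := by
    intro t ht
    have h1 := ht.1.ne'
    have := (((hasDerivAt_id t).const_sub 1).const_mul Λ).div (hasDerivAt_id t) h1
    refine HasDerivAt.hasDerivWithinAt ?_
    convert! this using 1
    simp only [id]
    field_simp
    ring
  -- The integrand after the substitution.
  have hsub : ∀ t ∈ Ioo (0 : ℝ) 1, Λ / t ^ 2 *
      (φ t ^ (-(1 / 2) : ℝ) / Real.Gamma (1 / 2) * deriv (mgf X P) (-φ t)) =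
      K * (w t * kR t) := by
    intro t ht
    have ht0 := ht.1
    have ht1 : 0 < 1 - t := sub_pos.2 ht.2
    have hxt := hx t (Ioo_subset_Icc_self ht)
    have hq : 0 < Λ / t := by positivity
    have hs : ∀ j, φ t + l j = Λ / t * (1 - z j * t) := by
      intro j
      simp only [hφ, hz]
      field_simp
      ring
    have e1 : ∏ j, (φ t + l j) ^ (-β j) = (Λ / t) ^ (-c) * ∏ j, (1 - z j * t) ^ (-β j) := by
      rw [← hβ, ← Finset.sum_neg_distrib, Real.rpow_sum_of_pos hq, ← Finset.prod_mul_distrib]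
      exact Finset.prod_congr rfl fun j _ ↦ by rw [hs, Real.mul_rpow hq.le (hxt j).le]
    have e2 : ∑ j, β j / (φ t + l j) =
        t / Λ * (c + ∑ j, β j * (z j * t) / (1 - z j * t)) := by
      rw [← hβ, ← Finset.sum_add_distrib, Finset.mul_sum]
      refine Finset.sum_congr rfl fun j _ ↦ ?_
      have := (hxt j).ne'
      have h2 : β j + β j * (z j * t) / (1 - z j * t) = β j / (1 - z j * t) := by
        rw [eq_div_iff this, add_mul, div_mul_cancel₀ _ this]
        ring
      rw [hs, h2]
      field_simp
    have e3 : φ t ^ (-(1 / 2) : ℝ) = (Λ / t) ^ (-(1 / 2) : ℝ) * (1 - t) ^ (1 / 2 - 1 : ℝ) := by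
      rw [show φ t = Λ / t * (1 - t) by simp only [hφ]; ring, Real.mul_rpow hq.le ht1.le]
      norm_num
    have e4 : (Λ / t) ^ (-(1 / 2) : ℝ) * (Λ / t) ^ (-c) =
        Λ ^ (-(c + 1 / 2)) * (t ^ (c + 1 / 2 - 1) * t) := by
      rw [← Real.rpow_add hq, Real.rpow_sub_one ht0.ne', div_mul_cancel₀ _ ht0.ne',
        show -(1 / 2) + -c = -(c + 1 / 2) by ring, Real.div_rpow hΛ.le ht0.le,
        Real.rpow_neg ht0.le, div_inv_eq_mul]
    rw [hderiv _ (hφpos t ht), e1, e2, e3]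
    simp only [hK, hw, hkR]
    calc _ = C / Real.Gamma (1 / 2) * ((Λ / t) ^ (-(1 / 2) : ℝ) * (Λ / t) ^ (-c)) *
          (1 - t) ^ (1 / 2 - 1 : ℝ) * ((c + ∑ j, β j * (z j * t) / (1 - z j * t)) *
          ∏ j, (1 - z j * t) ^ (-β j)) * (Λ / t ^ 2 * (t / Λ)) := by ring
      _ = _ := by
        rw [e4]
        field_simp
  -- The kernel is not visibly nonnegative, as some `βⱼ` may be negative; its sign comes from
  -- `E[X e^{-s X}] ≥ 0`.
  have hnn : ∀ t ∈ Ioo (0 : ℝ) 1, 0 ≤ w t * kR t := by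
    intro t ht
    have h1 := hφpos t ht
    have h2 := hderiv0 _ h1
    have h3 : 0 ≤ K * (w t * kR t) := by
      rw [← hsub t ht]
      have := ht.1
      positivity
    exact nonneg_of_mul_nonneg_right h3 hK0
  refine ⟨∫ t in Ioo (0 : ℝ) 1, w t * kR t, setIntegral_nonneg measurableSet_Ioo hnn, ?_, ?_⟩
  · rw [← integral_complex_ofReal]
    refine setIntegral_congr_fun measurableSet_Ioo fun t ht ↦ ?_
    have hxt := hx t (Ioo_subset_Icc_self ht)
    have e : ((∏ j, (1 - z j * t) ^ (-β j) : ℝ) : ℂ) =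
        ∏ j, (1 - (z j : ℂ) * t) ^ (-(β j : ℂ)) := by
      rw [Complex.ofReal_prod]
      refine Finset.prod_congr rfl fun j _ ↦ ?_
      rw [Complex.ofReal_cpow (hxt j).le]
      push_cast
      rfl
    rw [Complex.ofReal_mul]
    congr 1
    change _ = lauricellaKernel _ _ fun j ↦ (z j : ℂ) * t
    simp only [hkR, lauricellaKernel]
    rw [Complex.ofReal_mul, e]
    push_cast
    rfl
  · rw [lintegral_sqrt_eq_lintegral_deriv_mgf hX h0, ← hφimg,
      lintegral_image_eq_lintegral_abs_deriv_mul measurableSet_Ioo hφd hφinj,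
      ENNReal.ofReal_mul hK0.le, ofReal_integral_eq_lintegral_ofReal hwint
        ((ae_restrict_mem measurableSet_Ioo).mono fun t ht ↦ hnn t ht),
      ← lintegral_const_mul' _ _ ENNReal.ofReal_ne_top]
    refine setLIntegral_congr_fun measurableSet_Ioo fun t ht ↦ ?_
    have h1 : 0 < Λ / t ^ 2 := div_pos hΛ (pow_pos ht.1 2)
    rw [abs_neg, abs_of_pos h1, ← ENNReal.ofReal_mul h1.le, hsub t ht, ENNReal.ofReal_mul hK0.le]

/-! ### The error vector magnitude -/

/-- A variable equal to `0` may be dropped from the kernel of `F_D`. -/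
lemma lauricellaKernel_sum_of_eq_zero {n : ℕ} {κ : Type*} [Fintype κ] (b₁ : Fin (n + 1) → ℂ)
    (b₂ : κ → ℂ) (c : ℂ) (x : Fin (n + 1) ⊕ κ → ℂ) (hx : x (Sum.inl 0) = 0) :
    lauricellaKernel (Sum.elim b₁ b₂) c x =
      lauricellaKernel (Sum.elim (fun l : Fin n ↦ b₁ l.succ) b₂) c
        (Sum.elim (fun l : Fin n ↦ x (Sum.inl l.succ)) fun l ↦ x (Sum.inr l)) := by
  simp [lauricellaKernel, Fintype.sum_sum_type, Fintype.prod_sum_type, Fin.sum_univ_succ,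
    Fin.prod_univ_succ, hx]

end

/-- EVM of an interference-limited system with `L = n + 1` interferers; interferer `0` is the
distinguished (first) one. The `2 L - 1 = n + (n + 1)` variables of `F_D` are indexed by
`Fin n ⊕ Fin (n + 1)`. -/
theorem theorem1 {Ω : Type*} [MeasurableSpace Ω] (P : Measure Ω) [IsProbabilityMeasure P]
    (n : ℕ)
    (μ κ m : ℝ) (hμ : 1 / 2 < μ) (hκ : 0 < κ) (hm : 0 < m)
    (μI κI mI : Fin (n + 1) → ℝ)
    (hμI : ∀ l, 0 < μI l) (hκI : ∀ l, 0 < κI l) (hmI : ∀ l, 0 < mI l)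
    (gd : Ω → ℝ) (g : Fin (n + 1) → Ω → ℝ)
    (hgd : HasLaw gd (kappaMuShadowed μ κ m 1) P)
    (hg : ∀ l, HasLaw (g l) (kappaMuShadowed (μI l) (κI l) (mI l) 1) P)
    (hindep : iIndepFun g P)
    (hindep' : IndepFun gd (fun ω l => g l ω) P)
    (θ₁ θ₂ : ℝ) (θ₁I θ₂I : Fin (n + 1) → ℝ)
    (hθ₁ : θ₁ = 1 / (μ * (1 + κ)))
    (hθ₂ : θ₂ = (μ * κ + m) / (μ * (1 + κ) * m))
    (hθ₁I : ∀ l, θ₁I l = 1 / (μI l * (1 + κI l)))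
    (hθ₂I : ∀ l, θ₂I l = (μI l * κI l + mI l) / (μI l * (1 + κI l) * mI l))
    (a c : ℂ) (b z : Fin n ⊕ Fin (n + 1) → ℂ)
    (ha : a = (((∑ l, μI l) + 1 / 2 : ℝ) : ℂ))
    (hc : c = ((∑ l, μI l : ℝ) : ℂ))
    (hb : b = Sum.elim (fun l : Fin n => ((μI l.succ - mI l.succ : ℝ) : ℂ))
      (fun l : Fin (n + 1) => (mI l : ℂ)))
    (hz : z = Sum.elim (fun l : Fin n => ((1 - θ₁I 0 / θ₁I l.succ : ℝ) : ℂ))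
      (fun l : Fin (n + 1) => ((1 - θ₁I 0 / θ₂I l : ℝ) : ℂ))) :
    IsLauricellaFD a b c (lauricellaFD a b c) ∧
    z ∈ lauricellaFDDomain (Fin n ⊕ Fin (n + 1)) ∧
    Integrable (fun ω => √((∑ l, g l ω) / gd ω)) P ∧
    ((evm P 0 gd (fun ω => ∑ l, g l ω) : ℝ) : ℂ) =
      (((∏ l, θ₁I l ^ (mI l - μI l) * θ₂I l ^ (-mI l))
          * θ₁ ^ (m - μ) * θ₂ ^ (-m) * θ₁ ^ (μ - 1 / 2)
          * ordinaryHypergeometric (μ - 1 / 2) m μ (μ * κ / (m + μ * κ))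
          * θ₁I 0 ^ ((∑ l, μI l) + 1 / 2)
          * (Real.Gamma (μ - 1 / 2) * Real.Gamma ((∑ l, μI l) + 1 / 2)
              / (Real.Gamma μ * Real.Gamma (∑ l, μI l))) : ℝ) : ℂ)
        * lauricellaFD a b c z := by
  have hμ0 : 0 < μ := by linarith
  have h1 : 0 < θ₁ := by rw [hθ₁]; positivity
  have h2 : 0 < θ₂ := by rw [hθ₂]; positivity
  have h1I : ∀ l, 0 < θ₁I l := fun l ↦ by
    have := hμI l; have := hκI l; rw [hθ₁I]; positivity
  have h2I : ∀ l, 0 < θ₂I l := fun l ↦ by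
    have := hμI l; have := hκI l; have := hmI l; rw [hθ₂I]; positivity
  set S : ℝ := ∑ l, μI l with hS
  have hS0 : 0 < S := Finset.sum_pos (fun l _ ↦ hμI l) Finset.univ_nonempty
  have hFD : IsLauricellaFD a b c (lauricellaEuler (S + 1 / 2) b S) := by
    rw [ha, hc]
    exact isLauricellaFD_lauricellaEuler b (by positivity) hS0 (by linarith)
  have hzdom : z ∈ lauricellaFDDomain (Fin n ⊕ Fin (n + 1)) := by
    rw [hz]
    rintro (l | l)
    · have := div_pos (h1I 0) (h1I l.succ)
      simp only [Sum.elim_inl, Complex.ofReal_sub, Complex.ofReal_one, sub_sub_cancel]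
      exact Complex.ofReal_mem_slitPlane.2 this
    · have := div_pos (h1I 0) (h2I l)
      simp only [Sum.elim_inr, Complex.ofReal_sub, Complex.ofReal_one, sub_sub_cancel]
      exact Complex.ofReal_mem_slitPlane.2 this
  refine ⟨hFD.lauricellaFD, hzdom, ?_⟩
  rw [hFD.lauricellaFD.eqOn hFD hzdom]
  -- The total interference: its Laplace transform and its half moment.
  have hgm : ∀ l, AEMeasurable (g l) P := fun l ↦ (hg l).aemeasurable
  have hgpos : ∀ᵐ ω ∂P, ∀ l, 0 < g l ω :=
    ae_all_iff.2 fun l ↦ ae_pos_of_hasLaw_kappaMuShadowed (hμI l) (hg l)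
  set X : Ω → ℝ := fun ω ↦ ∑ l, g l ω with hX
  have hXm : AEMeasurable X P := by fun_prop
  have hXpos : ∀ᵐ ω ∂P, 0 < X ω := by
    filter_upwards [hgpos] with ω hω
    exact Finset.sum_pos (fun l _ ↦ hω l) Finset.univ_nonempty
  set C : ℝ := ∏ l, θ₁I l ^ (mI l - μI l) * θ₂I l ^ (-mI l) with hC
  have hC0 : 0 < C := Finset.prod_pos fun l _ ↦
    mul_pos (Real.rpow_pos_of_pos (h1I l) _) (Real.rpow_pos_of_pos (h2I l) _)
  have hM : ∀ s, 0 < s → mgf X P (-s) = C * ∏ j : Fin (n + 1) ⊕ Fin (n + 1),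
      (s + Sum.elim (fun l ↦ 1 / θ₁I l) (fun l ↦ 1 / θ₂I l) j) ^
        (-Sum.elim (fun l ↦ μI l - mI l) mI j) := by
    intro s hs
    have h := hindep.mgf_sum₀ hgm Finset.univ (t := -s)
    rw [show (∑ l, g l) = X by ext ω; simp [hX]] at h
    rw [h, Fintype.prod_sum_type, ← Finset.prod_mul_distrib, hC, ← Finset.prod_mul_distrib]
    exact Finset.prod_congr rfl fun l _ ↦ mgf_of_hasLaw_kappaMuShadowed (hμI l) (hκI l) (hmI l)
      (hθ₁I l) (hθ₂I l) (hg l) hs.le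
  obtain ⟨J, hJ0, hJ, hXJ⟩ := lintegral_sqrt_of_mgf_eq_prod hXm hXpos hC0
    (by rintro (l | l) <;> simp [h1I, h2I]) (one_div_pos.2 (h1I 0)) hS0
    (by simp [Fintype.sum_sum_type, hS]) hM
  -- The first interferer's variable vanishes, since the scale is `θ₁I 0`.
  have hker : ∀ t : ℝ, (lauricellaKernel (fun j : Fin (n + 1) ⊕ Fin (n + 1) ↦
      ((Sum.elim (fun l ↦ μI l - mI l) mI j : ℝ) : ℂ)) S fun j ↦
      ((1 - Sum.elim (fun l ↦ 1 / θ₁I l) (fun l ↦ 1 / θ₂I l) j / (1 / θ₁I 0) : ℝ) : ℂ) * t) =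
      lauricellaKernel b S fun i ↦ z i * t := by
    intro t
    have hdiv : ∀ x, 1 / x / (1 / θ₁I 0) = θ₁I 0 / x := fun x ↦ by
      rw [one_div, one_div, div_inv_eq_mul, mul_comm, div_eq_mul_inv]
    have hne : 1 / θ₁I 0 ≠ 0 := (one_div_pos.2 (h1I 0)).ne'
    have h := lauricellaKernel_sum_of_eq_zero (fun l ↦ ((μI l - mI l : ℝ) : ℂ))
      (fun l ↦ (mI l : ℂ)) S (fun j : Fin (n + 1) ⊕ Fin (n + 1) ↦
      ((1 - Sum.elim (fun l ↦ 1 / θ₁I l) (fun l ↦ 1 / θ₂I l) j / (1 / θ₁I 0) : ℝ) : ℂ) * t)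
      (by rw [Sum.elim_inl, div_self hne, sub_self, Complex.ofReal_zero, zero_mul])
    convert! h using 2
    · ext (l | l) <;> rfl
    · rw [hz]
      ext (l | l) <;> simp only [Sum.elim_inl, Sum.elim_inr, hdiv]
  simp only [hker] at hJ
  -- The desired signal enters through its moment of order `-1/2`.
  have hgdm := hgd.aemeasurable
  have hgdpos := ae_pos_of_hasLaw_kappaMuShadowed hμ0 hgd
  have hA := lintegral_inv_sqrt_of_hasLaw_kappaMuShadowed hμ hκ hm hθ₁ hθ₂ hgd
  set A : ℝ := θ₁ ^ (m - μ) * θ₂ ^ (-m) * θ₁ ^ (μ - 1 / 2) *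
        ordinaryHypergeometric (μ - 1 / 2) m μ (μ * κ / (m + μ * κ)) *
        (Real.Gamma (μ - 1 / 2) / Real.Gamma μ) with hAdef
  have hA0 : 0 ≤ A := by
    have e1 : 0 ≤ ordinaryHypergeometric (μ - 1 / 2) m μ (μ * κ / (m + μ * κ)) :=
      ordinaryHypergeometric_nonneg (by linarith) hm hμ0 (by positivity)
        ((div_lt_one (by positivity)).2 (by linarith))
    have e2 := Real.Gamma_pos_of_pos (show 0 < μ - 1 / 2 by linarith)
    have e3 := Real.Gamma_pos_of_pos hμ0
    positivity
  set B : ℝ := C * (1 / θ₁I 0) ^ (-(S + 1 / 2)) / Real.Gamma (1 / 2) * J with hB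
  have hΓ : 0 < Real.Gamma (1 / 2) := Real.Gamma_pos_of_pos (by norm_num)
  have hB0 : 0 ≤ B := by
    have := h1I 0
    positivity
  have hratio : ∫⁻ ω, ENNReal.ofReal √(X ω / gd ω) ∂P = ENNReal.ofReal (A * B) := by
    have hind : IndepFun (fun ω ↦ ENNReal.ofReal (gd ω ^ (-(1 / 2) : ℝ)))
        (fun ω ↦ ENNReal.ofReal √(X ω)) P :=
      hindep'.comp (φ := fun x : ℝ ↦ ENNReal.ofReal (x ^ (-(1 / 2) : ℝ)))
        (ψ := fun v : Fin (n + 1) → ℝ ↦ ENNReal.ofReal √(∑ l, v l)) (by fun_prop) (by fun_prop)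
    rw [ENNReal.ofReal_mul hA0, ← hA, ← hXJ, ← lintegral_mul_eq_lintegral_mul_lintegral_of_indepFun''
      (by fun_prop) (by fun_prop) hind]
    refine lintegral_congr_ae ?_
    filter_upwards [hgdpos] with ω hω
    rw [← ENNReal.ofReal_mul (by positivity), Real.sqrt_div' _ hω.le, Real.rpow_neg hω.le,
      ← Real.sqrt_eq_rpow, div_eq_inv_mul]
  have hratiom : AEStronglyMeasurable (fun ω ↦ √(X ω / gd ω)) P :=
    (by fun_prop : AEMeasurable (fun ω ↦ √(X ω / gd ω)) P).aestronglyMeasurable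
  have hratio0 : 0 ≤ᵐ[P] fun ω ↦ √(X ω / gd ω) :=
    Filter.Eventually.of_forall fun ω ↦ Real.sqrt_nonneg _
  refine ⟨⟨hratiom, ?_⟩, ?_⟩
  · rw [hasFiniteIntegral_iff_ofReal hratio0, hratio]
    exact ENNReal.ofReal_lt_top
  · have hevm : evm P 0 gd X = A * B := by
      simp only [evm, add_zero]
      rw [integral_eq_lintegral_of_nonneg_ae hratio0 hratiom, hratio,
        ENNReal.toReal_ofReal (mul_nonneg hA0 hB0)]
    have hexp : S + 1 - (S + 1 / 2) = 1 / 2 := by ring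
    rw [hevm, lauricellaEuler, hexp, ← hJ, ← Complex.ofReal_mul, ← Complex.ofReal_mul,
      hB, hAdef, one_div (θ₁I 0), Real.inv_rpow (h1I 0).le, ← Real.rpow_neg (h1I 0).le, neg_neg]
    congr 1
    have e1 := (Real.Gamma_pos_of_pos (show 0 < S + 1 / 2 by linarith)).ne'
    have e2 := (Real.Gamma_pos_of_pos hS0).ne'
    field_simp
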